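/- Let $K\in\{\mathbb R,\mathbb C\}$. For a Banach space $X$ over $K$, its emboundment $\mathfrak M_X$ is the continuous-logic structure with underlying set $X\sqcup\{\infty\}$, constants $\mathbf 0,\infty$, and, writing $\theta(t)=t/(1+t)$, $$d(x,y)=\frac{\theta(\|x-y\|)}{1+\min(\|x\|,\|y\|)},\qquad d(x,\infty)=\frac1{1+\|x\|},$$ $$P(x,y,z)=\frac{\theta(\|x+y-z\|)}{1+\max(\|x\|,\|y\|,\|z\|)},\qquad S_t(x,y)=\frac{\theta(\|tx-y\|)}{1+\max(\|x\|,\|y\|)}\quad(t\in K)$$ for $x,y,z\in X$, where $P$ and $S_t$ are $0$ if some argument is $\infty$. Let $T$ be the theory whose models are these emboundments. Formulas may use arbitrary continuous connectives $\mathbb R^\omega\to\mathbb R$. Write $[u]_a^b=\min(\max(u,a),b)$ and $\log 0=-\infty$. For real $r>\tfrac12$ and $s\in K$ let $$\varphi_r(x,y,z)=\bigl[r-r^{-2}\log\max(\|x\|,\|y\|,\|z\|)\bigr]_0^1\cdot\bigl[(2-r^{-1})\log\|x+y-z\|\bigr]_{-r}^{r},$$ $$\psi_{r,s}(x,y)=\bigl[r-r^{-2}\log\max(\|x\|,\|y\|)\bigr]_0^1\cdot\bigl[(2-r^{-1})\log\|sx-y\|\bigr]_{-r}^{r},$$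 both understood to be $0$ if some argument is $\infty$. Let $\mathrm{BM}_0$ be the set of formulas that define in all models of $T$ one of these quantities, possibly with the constant $\mathbf 0$ substituted for some of the variables, and let $\mathrm{BM}=\overline{\mathrm{BM}_0}$ be its closure under renaming variables, quantification, connectives that are $1$-Lipschitz for the max metric, logical equivalence modulo $T$, and uniformly convergent limits (modulo $T$). A correlation between $\mathfrak M$ and $\mathfrak N$ is a relation $R\subseteq\mathfrak M\times\mathfrak N$ that is total and surjective. Put $$\mathrm{dis}_{\mathrm{BM}}(R)=\sup\{|\varphi^{\mathfrak M}(\bar m)-\varphi^{\mathfrak N}(\bar n)|:\varphi\in\mathrm{BM},\ (\bar m,\bar n)\in R\}\in[0,\infty],$$ where $(\bar m,\bar n)\in R$ means $(m_i,n_i)\in R$ for all $i$, and let $\rho_{\mathrm{BM}}(\mathfrak M,\mathfrak N)$ be the infimum of $\mathrm{dis}_{\mathrm{BM}}(R)$ over all correlations $R$ between $\mathfrak M$ and $\mathfrak N$. Let $X$ and $Y$ be Banach spaces over $K$ with emboundments $\mathfrak M$ and $\mathfrak N$. 1. For every closed correlation $R$ between $\mathfrak M$ and $\mathfrak N$ and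 every real $\varepsilon\ge 0$, one has $\mathrm{dis}_{\mathrm{BM}}(R)\le\varepsilon$ if and only if $R$ is the graph of a linear bijection $A:X\to Y$ together with the pair $(\infty^{\mathfrak M},\infty^{\mathfrak N})$, where $\|A\|\le\sqrt{e^{\varepsilon}}$ and $\|A^{-1}\|\le\sqrt{e^{\varepsilon}}$. 2. Consequently $\rho_{\mathrm{BM}}(\mathfrak M,\mathfrak N)=d_{\mathrm{BM}}(X,Y)$, where $$d_{\mathrm{BM}}(X,Y)=\inf\{\log(\|A\|\,\|A^{-1}\|) : A:X\to Y\text{ a linear homeomorphism}\}\in[0,\infty],$$ the infimum being $\infty$ if there is no such $A$, and $0$ if $X$ and $Y$ are both the zero space. -/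

import Mathlib

universe u w

namespace Emboundment

/-! ### Emboundments of Banach spaces -/

/-- The underlying set of the emboundment of `X`: the points of `X` and one more point `∞`. -/
inductive Embound (X : Type u) : Type u
  | pt (x : X) : Embound X
  | infty : Embound X

/-- The function `θ(t) = t / (1 + t)`, used for `t ≥ 0`. -/
noncomputable def theta (t : ℝ) : ℝ := t / (1 + t)

namespace Embound

variable {X : Type u} [NormedAddCommGroup X]

/-- The distance of the emboundment. -/
noncomputable def distance : Embound X → Embound X → ℝ
  | pt x, pt y => theta ‖x - y‖ / (1 + min ‖x‖ ‖y‖)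
  | pt x, infty => 1 / (1 + ‖x‖)
  | infty, pt y => 1 / (1 + ‖y‖)
  | infty, infty => 0

/-- The predicate `P`, which codes addition. -/
noncomputable def P : Embound X → Embound X → Embound X → ℝ
  | pt x, pt y, pt z => theta ‖x + y - z‖ / (1 + max (max ‖x‖ ‖y‖) ‖z‖)
  | _, _, _ => 0

/-- The predicate `S_r`, which codes multiplication by the scalar `r`. -/
noncomputable def S {K : Type w} [RCLike K] [NormedSpace K X] (r : K) :
    Embound X → Embound X → ℝ
  | pt x, pt y => theta ‖r • x - y‖ / (1 + max ‖x‖ ‖y‖)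
  | _, _ => 0

theorem theta_tri (a b c p q s : ℝ) (ha : 0 ≤ a) (hb : 0 ≤ b) (hc : 0 ≤ c) (hp : 0 ≤ p)
    (hq : 0 ≤ q) (hs : 0 ≤ s) (hspq : s ≤ p + q) (hab : b ≤ a + p) (hac : a ≤ c) :
    theta s / (1 + min a c) ≤ theta p / (1 + min a b) + theta q / (1 + min b c) := by
  have hmono : theta s ≤ theta (p + q) := by
    unfold theta
    rw [div_le_div_iff₀ (by positivity) (by positivity)]
    nlinarith
  have hsplit : theta (p + q) = theta p + q / ((1 + p) * (1 + p + q)) := by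
    unfold theta; field_simp; ring
  have hqp : q / ((1 + p) * (1 + p + q)) ≤ theta q := by
    unfold theta
    apply div_le_div_of_nonneg_left hq (by positivity)
    nlinarith [mul_nonneg hp hq]
  have hp0 : 0 ≤ theta p := by unfold theta; positivity
  have hq0 : 0 ≤ theta q := by unfold theta; positivity
  rw [min_eq_left hac]
  rcases le_total b a with hba | hba
  · rw [min_eq_right hba, min_eq_left (hba.trans hac), ← add_div]
    apply div_le_div₀ (by positivity) (by linarith) (by positivity) (by linarith)
  · rw [min_eq_left hba]
    have hm : min b c ≤ a + p := (min_le_left _ _).trans hab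
    have hm0 : 0 ≤ min b c := le_min hb hc
    have key : q / ((1 + p) * (1 + p + q)) / (1 + a) ≤ theta q / (1 + min b c) := by
      unfold theta
      rw [div_div, div_div]
      apply div_le_div_of_nonneg_left hq (by positivity)
      have h1 : 1 + min b c ≤ (1 + p) * (1 + a) := by nlinarith [mul_nonneg hp ha]
      calc (1 + q) * (1 + min b c) ≤ (1 + p + q) * ((1 + p) * (1 + a)) := by
            apply mul_le_mul (by linarith) h1 (by positivity) (by positivity)
        _ = _ := by ring
    calc theta s / (1 + a) ≤ theta (p + q) / (1 + a) := by gcongr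
      _ = theta p / (1 + a) + q / ((1 + p) * (1 + p + q)) / (1 + a) := by
          rw [hsplit, add_div]
      _ ≤ _ := by linarith

theorem infty_tri (a b t : ℝ) (ha : 0 ≤ a) (hb : 0 ≤ b) (ht : 0 ≤ t) (hab : b ≤ a + t) :
    1 / (1 + a) ≤ theta t / (1 + min a b) + 1 / (1 + b) := by
  have ht0 : 0 ≤ theta t := by unfold theta; positivity
  rcases le_total b a with h | h
  · have h1 : 1 / (1 + a) ≤ 1 / (1 + b) := by gcongr
    have h2 : 0 ≤ theta t / (1 + min a b) := div_nonneg ht0 (by positivity)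
    linarith
  · rw [min_eq_left h]
    unfold theta
    rw [div_div, div_add_div _ _ (by positivity) (by positivity),
      div_le_div_iff₀ (by positivity) (by positivity)]
    have h1 : 0 ≤ t * (1 + b) + (1 + t) * (1 + a) - (1 + t) * (1 + b) := by nlinarith
    nlinarith [mul_nonneg h1 (by positivity : 0 ≤ 1 + a)]

noncomputable instance : MetricSpace (Embound X) where
  dist := distance
  dist_self x := by cases x <;> simp [distance, theta]
  dist_comm x y := by
    cases x <;> cases y <;> simp [distance, norm_sub_rev, min_comm]
  dist_triangle x y z := by
    have hb : ∀ v v' : X, ‖v'‖ ≤ ‖v‖ + ‖v - v'‖ := fun v v' => by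
      have := norm_sub_le v (v - v')
      simpa using this
    have hb' : ∀ v v' : X, ‖v'‖ ≤ ‖v‖ + ‖v' - v‖ := fun v v' => by
      rw [norm_sub_rev]; exact hb v v'
    have hth : ∀ t : ℝ, 0 ≤ t → 0 ≤ theta t := fun t ht => by unfold theta; positivity
    have hth1 : ∀ t : ℝ, 0 ≤ t → theta t ≤ 1 := fun t ht => by
      unfold theta; rw [div_le_one (by positivity)]; linarith
    cases x with
    | infty =>
      cases y with
      | infty => cases z <;> simp [distance]
      | pt y =>
        cases z with
        | infty => simp only [distance]; positivity
        | pt z =>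
          simp only [distance]
          have := infty_tri ‖z‖ ‖y‖ ‖y - z‖ (norm_nonneg _) (norm_nonneg _) (norm_nonneg _)
            (hb' _ _)
          rw [min_comm] at this
          linarith
    | pt x =>
      cases y with
      | infty =>
        cases z with
        | infty => simp [distance]
        | pt z =>
          simp only [distance]
          have h1 : theta ‖x - z‖ / (1 + min ‖x‖ ‖z‖) ≤ 1 / (1 + min ‖x‖ ‖z‖) := by
            gcongr
            exact hth1 _ (norm_nonneg _)
          have h2 : 0 ≤ 1 / (1 + ‖x‖) := by positivity
          have h3 : 0 ≤ 1 / (1 + ‖z‖) := by positivity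
          rcases min_choice ‖x‖ ‖z‖ with h | h <;> rw [h] at h1 ⊢ <;> linarith
      | pt y =>
        cases z with
        | infty =>
          simp only [distance]
          exact infty_tri _ _ _ (norm_nonneg _) (norm_nonneg _) (norm_nonneg _) (hb _ _)
        | pt z =>
          simp only [distance]
          rcases le_total ‖x‖ ‖z‖ with h | h
          · exact theta_tri _ _ _ _ _ _ (norm_nonneg _) (norm_nonneg _) (norm_nonneg _)
              (norm_nonneg _) (norm_nonneg _) (norm_nonneg _) (norm_sub_le_norm_sub_add_norm_sub _ _ _)
              (hb _ _) h
          · have := theta_tri ‖z‖ ‖y‖ ‖x‖ ‖y - z‖ ‖x - y‖ ‖x - z‖ (norm_nonneg _) (norm_nonneg _)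
              (norm_nonneg _) (norm_nonneg _) (norm_nonneg _) (norm_nonneg _)
              (by rw [add_comm]; exact norm_sub_le_norm_sub_add_norm_sub _ _ _) (hb' _ _) h
            rw [min_comm ‖z‖ ‖x‖, min_comm ‖z‖ ‖y‖, min_comm ‖y‖ ‖x‖] at this
            linarith
  eq_of_dist_eq_zero {x y} h := by
    change distance x y = 0 at h
    have hpos : ∀ t : ℝ, 0 ≤ t → (1 + t) ≠ 0 := fun t ht => by positivity
    cases x with
    | infty =>
      cases y with
      | infty => rfl
      | pt y => simp [distance, hpos ‖y‖ (norm_nonneg _)] at h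
    | pt x =>
      cases y with
      | infty => simp [distance, hpos ‖x‖ (norm_nonneg _)] at h
      | pt y =>
        have h1 := hpos ‖x - y‖ (norm_nonneg _)
        have h2 := hpos (min ‖x‖ ‖y‖) (le_min (norm_nonneg _) (norm_nonneg _))
        simp only [distance, theta, div_eq_zero_iff, h1, h2, or_false, norm_eq_zero,
          sub_eq_zero] at h
        rw [h]

end Embound

open Embound

/-! ### Continuous logic in the language of emboundments -/

/-- Terms in `n` free variables: variables and the constants `𝟎` and `∞`. -/
inductive Term (n : ℕ) : Type
  | var (i : Fin n) : Term n
  | zero : Term n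
  | infty : Term n

/-- First-order formulas of continuous logic over the signature `d, 𝟎, ∞, P, S_r (r ∈ K)` with free
variables among `x_0, …, x_{n-1}`. Connectives are arbitrary continuous functions `ℝ^ω → ℝ`
(a connective of finite arity is one that ignores all but finitely many arguments). The
quantifiers bind the variable `x_0` and shift the others. -/
inductive Formula (K : Type w) : ℕ → Type w
  | dist {n : ℕ} (s t : Term n) : Formula K n
  | P {n : ℕ} (s t u : Term n) : Formula K n
  | S {n : ℕ} (r : K) (s t : Term n) : Formula K n
  | conn {n : ℕ} (F : C(ℕ → ℝ, ℝ)) (φ : ℕ → Formula K n) : Formula K n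
  | inf {n : ℕ} (φ : Formula K (n + 1)) : Formula K n
  | sup {n : ℕ} (φ : Formula K (n + 1)) : Formula K n

/-- Renaming of variables in terms. -/
def Term.rename {n m : ℕ} (σ : Fin n → Fin m) : Term n → Term m
  | .var i => .var (σ i)
  | .zero => .zero
  | .infty => .infty

/-- Renaming of free variables in formulas. -/
def Formula.rename {K : Type w} : {n : ℕ} → Formula K n → {m : ℕ} → (Fin n → Fin m) → Formula K m
  | _, .dist s t, _, σ => .dist (s.rename σ) (t.rename σ)
  | _, .P s t u, _, σ => .P (s.rename σ) (t.rename σ) (u.rename σ)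
  | _, .S r s t, _, σ => .S r (s.rename σ) (t.rename σ)
  | _, .conn F φ, _, σ => .conn F fun i => (φ i).rename σ
  | _, .inf φ, _, σ => .inf (φ.rename (Fin.cons 0 fun i => (σ i).succ))
  | _, .sup φ, _, σ => .sup (φ.rename (Fin.cons 0 fun i => (σ i).succ))

section Semantics

variable {X : Type u} [NormedAddCommGroup X]

/-- The value of a term in the emboundment of `X`. -/
def Term.eval {n : ℕ} (v : Fin n → Embound X) : Term n → Embound X
  | .var i => v i
  | .zero => pt 0
  | .infty => Embound.infty

/-- The value `φ^𝔐(v)` of a formula in the emboundment `𝔐` of `X`. (All atomic formulas take values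
in `[0, 1]` and connectives are continuous, so the infima and suprema are over bounded sets.) -/
noncomputable def Formula.eval {K : Type w} [RCLike K] [NormedSpace K X] :
    {n : ℕ} → Formula K n → (Fin n → Embound X) → ℝ
  | _, .dist s t, v => Dist.dist (s.eval v) (t.eval v)
  | _, .P s t u, v => Embound.P (s.eval v) (t.eval v) (u.eval v)
  | _, .S r s t, v => Embound.S r (s.eval v) (t.eval v)
  | _, .conn F φ, v => F fun i => (φ i).eval v
  | _, .inf φ, v => ⨅ a : Embound X, φ.eval (Fin.cons a v : Fin _ → Embound X)
  | _, .sup φ, v => ⨆ a : Embound X, φ.eval (Fin.cons a v : Fin _ → Embound X)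

end Semantics

/-- A collection of formulas, each in finitely many free variables. -/
abbrev FormulaSet (K : Type w) := ∀ n : ℕ, Set (Formula K n)

/-- `φ` and `ψ` differ by at most `ε` in all models of the theory `T` of emboundments of Banach
spaces over `K` (the models of `T` are exactly these emboundments). -/
def UniformlyClose {K : Type w} [RCLike K] {n : ℕ} (ε : ℝ) (φ ψ : Formula K n) : Prop :=
  ∀ (E : Type u) [NormedAddCommGroup E] [NormedSpace K E] [CompleteSpace E]
    (v : Fin n → Embound E), |φ.eval v - ψ.eval v| ≤ ε

/-- Logical equivalence modulo `T`. -/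
def LogicallyEquivalent {K : Type w} [RCLike K] {n : ℕ} (φ ψ : Formula K n) : Prop :=
  ∀ (E : Type u) [NormedAddCommGroup E] [NormedSpace K E] [CompleteSpace E]
    (v : Fin n → Embound E), φ.eval v = ψ.eval v

/-- A connective that is `1`-Lipschitz in the sense of the max metric. -/
def IsOneLipschitz (F : C(ℕ → ℝ, ℝ)) : Prop :=
  ∀ (x y : ℕ → ℝ) (ε : ℝ), (∀ i, |x i - y i| ≤ ε) → |F x - F y| ≤ ε

/-- The closure `Δ̄` of a collection of formulas under renaming variables, quantification,
`1`-Lipschitz connectives, logical equivalence modulo `T` and uniformly convergent limits. -/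
inductive Closure {K : Type w} [RCLike K] (Δ : FormulaSet K) : ∀ n : ℕ, Formula K n → Prop
  | base {n : ℕ} {φ : Formula K n} (h : φ ∈ Δ n) : Closure Δ n φ
  | rename {n m : ℕ} {φ : Formula K n} (σ : Fin n → Fin m) (h : Closure Δ n φ) :
      Closure Δ m (φ.rename σ)
  | inf {n : ℕ} {φ : Formula K (n + 1)} (h : Closure Δ (n + 1) φ) : Closure Δ n φ.inf
  | sup {n : ℕ} {φ : Formula K (n + 1)} (h : Closure Δ (n + 1) φ) : Closure Δ n φ.sup
  | conn {n : ℕ} {F : C(ℕ → ℝ, ℝ)} (hF : IsOneLipschitz F) {φ : ℕ → Formula K n}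
      (h : ∀ i, Closure Δ n (φ i)) : Closure Δ n (.conn F φ)
  | equiv {n : ℕ} {φ ψ : Formula K n} (h : Closure Δ n φ)
      (he : LogicallyEquivalent.{u} φ ψ) : Closure Δ n ψ
  | limit {n : ℕ} {φ : ℕ → Formula K n} {ψ : Formula K n} (h : ∀ i, Closure Δ n (φ i))
      (hl : ∀ ε : ℝ, 0 < ε → ∃ N, ∀ i ≥ N, UniformlyClose.{u} ε (φ i) ψ) : Closure Δ n ψ

/-- The collection `Δ̄`. -/
def closureSet {K : Type w} [RCLike K] (Δ : FormulaSet K) : FormulaSet K :=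
  fun n => {φ | Closure.{u} Δ n φ}

/-! ### Correlations, distortion, and the distance `ρ_Δ` -/

/-- A correlation: a total surjective relation. -/
def IsCorrelation {M N : Type u} (R : Set (M × N)) : Prop :=
  (∀ a, ∃ b, (a, b) ∈ R) ∧ ∀ b, ∃ a, (a, b) ∈ R

section Distance

variable {K : Type w} [RCLike K] {X Y : Type u}
  [NormedAddCommGroup X] [NormedSpace K X] [NormedAddCommGroup Y] [NormedSpace K Y]

/-- The distortion `dis_Δ(R) ∈ [0, ∞]`. -/
noncomputable def dis (Δ : FormulaSet K) (R : Set (Embound X × Embound Y)) : ENNReal :=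
  ⨆ (n : ℕ) (φ : Formula K n) (_ : φ ∈ Δ n) (v : Fin n → Embound X) (w : Fin n → Embound Y)
    (_ : ∀ i, (v i, w i) ∈ R), ENNReal.ofReal |φ.eval v - φ.eval w|

variable (X Y) in
/-- The distance `ρ_Δ ∈ [0, ∞]` between the emboundments of `X` and `Y`. -/
noncomputable def rho (Δ : FormulaSet K) : ENNReal :=
  ⨅ (R : Set (Embound X × Embound Y)) (_ : IsCorrelation R), dis Δ R

variable (K X Y) in
/-- The Banach-Mazur distance `inf log (‖A‖ ‖A⁻¹‖) ∈ [0, ∞]` over linear homeomorphisms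
`A : X → Y`; it is `∞` if there are none. (`‖A‖ ‖A⁻¹‖ ≥ 1` unless `X` is the zero space, in which
case `Real.log 0 = 0` gives the value `0`.) -/
noncomputable def banachMazurDist : ENNReal :=
  ⨅ A : X ≃L[K] Y,
    ENNReal.ofReal (Real.log (‖(A : X →L[K] Y)‖ * ‖(A.symm : Y →L[K] X)‖))

/-- The graph of `A` together with the pair `(∞, ∞)`. -/
def graphWithInfty (A : X ≃L[K] Y) : Set (Embound X × Embound Y) :=
  {p | (∃ x : X, p = (pt x, pt (A x))) ∨ p = (Embound.infty, Embound.infty)}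

end Distance

/-! ### The Banach-Mazur formulas -/

/-- `[x]_a^b = min (max x a) b`. -/
noncomputable def clip (a b x : ℝ) : ℝ := min (max x a) b

/-- `[r - r⁻² log t]_0^1` for `t ≥ 0`, where `log 0 = -∞`. -/
noncomputable def cutoff (r t : ℝ) : ℝ :=
  if t = 0 then 1 else clip 0 1 (r - (r ^ 2)⁻¹ * Real.log t)

/-- `[(2 - r⁻¹) log t]_{-r}^r` for `t ≥ 0` and `r > 1/2`, where `log 0 = -∞`. -/
noncomputable def clippedLog (r t : ℝ) : ℝ :=
  if t = 0 then -r else clip (-r) r ((2 - r⁻¹) * Real.log t)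

section BM

variable {X : Type u} [NormedAddCommGroup X]

/-- The quantity `φ_r(x, y, z)`. -/
noncomputable def phi (r : ℝ) : Embound X → Embound X → Embound X → ℝ
  | pt x, pt y, pt z => cutoff r (max (max ‖x‖ ‖y‖) ‖z‖) * clippedLog r ‖x + y - z‖
  | _, _, _ => 0

/-- The quantity `ψ_{r,s}(x, y)`. -/
noncomputable def psi {K : Type w} [RCLike K] [NormedSpace K X] (r : ℝ) (s : K) :
    Embound X → Embound X → ℝ
  | pt x, pt y => cutoff r (max ‖x‖ ‖y‖) * clippedLog r ‖s • x - y‖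
  | _, _ => 0

end BM

/-- The terms that may be substituted: variables and the constant `𝟎`. -/
def Term.IsVarOrZero {n : ℕ} (t : Term n) : Prop := t = .zero ∨ ∃ i, t = .var i

/-- `BM₀`: the formulas that define in all models of `T` one of the quantities `φ_r`, `ψ_{r,s}`
(`r > 1/2`, `s ∈ K`), with variables or the constant `𝟎` as arguments. -/
def BM₀ (K : Type w) [RCLike K] : FormulaSet K := fun n =>
  {χ | (∃ r : ℝ, 1 / 2 < r ∧ ∃ t₁ t₂ t₃ : Term n,
          t₁.IsVarOrZero ∧ t₂.IsVarOrZero ∧ t₃.IsVarOrZero ∧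
          ∀ (E : Type u) [NormedAddCommGroup E] [NormedSpace K E] [CompleteSpace E]
            (v : Fin n → Embound E), χ.eval v = phi r (t₁.eval v) (t₂.eval v) (t₃.eval v)) ∨
       (∃ r : ℝ, 1 / 2 < r ∧ ∃ s : K, ∃ t₁ t₂ : Term n,
          t₁.IsVarOrZero ∧ t₂.IsVarOrZero ∧
          ∀ (E : Type u) [NormedAddCommGroup E] [NormedSpace K E] [CompleteSpace E]
            (v : Fin n → Embound E), χ.eval v = psi r s (t₁.eval v) (t₂.eval v))}

/-- The collection `BM`, the closure of `BM₀`. -/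
def BM (K : Type w) [RCLike K] : FormulaSet K := closureSet.{u} (BM₀.{u} K)

end Emboundment

/-!
A formula that changes by at most `ε` along a correlation keeps doing so under all the closure
operations, so only the formulas in `BM₀` matter (`dis_BM_le_iff`); quantifiers cause no trouble
because formulas are bounded.

If `A` and its inverse have norm at most `e^{ε/2}`, then all norms in `φ_r` and `ψ_{r,s}` change by
factors between `e^{-ε/2}` and `e^{ε/2}`. The cutoff, with slope `r⁻²`, multiplies a quantity bounded
by `r`, and the logarithm has slope `2 - r⁻¹`, so the total change is at most
`(r⁻² * r + (2 - r⁻¹)) * ε / 2 = ε` (`abs_cutoff_mul_clippedLog_sub_le`).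

Conversely, the quantities `φ_r` and `ψ_{r,s}` are definable: `d(x, 0) = θ(‖x‖)` is `1` exactly for
`x = ∞`, dividing `P` or `S_s` by `1 - θ(max)` recovers `θ` of the norm, and the cutoff removes the
pole of that division (`exists_formula_eval_eq_phi`, `exists_formula_eval_eq_psi`). Letting `r → ∞` in
`|φ_r(x, y, z) - φ_r(x', y', z')| ≤ ε` gives `‖x' + y' - z'‖ ≤ e^{ε/2} ‖x + y - z‖`, and likewise for
`ψ_{r,s}` (`le_exp_mul_of_forall_abs_sub_le`). In particular `x + y = z` implies `x' + y' = z'`, and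
similarly for multiples, so the correlation is the graph of a linear bijection with the norm bounds
required, together with `(∞, ∞)` (`DistortsAtMost.exists_equiv`). This does not use that the
correlation is closed, and so it also computes the infimum over all correlations, after `A` is
rescaled to have the same norm as its inverse (`exists_equiv_norm_le_sqrt`).
-/

namespace Emboundment

open Embound Filter

/-! ### Formulas along a correlation -/

section Formulas

variable {K : Type w} [RCLike K] {X Y : Type u}
  [NormedAddCommGroup X] [NormedSpace K X] [NormedAddCommGroup Y] [NormedSpace K Y]

instance (X : Type u) : Nonempty (Embound X) := ⟨Embound.infty⟩

theorem Term.eval_rename {n m : ℕ} (t : Term n) (σ : Fin n → Fin m) (v : Fin m → Embound X) :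
    (t.rename σ).eval v = t.eval (v ∘ σ) := by
  cases t <;> rfl

theorem Formula.eval_rename {n : ℕ} (φ : Formula K n) :
    ∀ {m : ℕ} (σ : Fin n → Fin m) (v : Fin m → Embound X),
      (φ.rename σ).eval v = φ.eval (v ∘ σ) := by
  have cons_comp : ∀ {n m : ℕ} (σ : Fin n → Fin m) (v : Fin m → Embound X) (a : Embound X),
      (Fin.cons a v : Fin (m + 1) → Embound X) ∘
        (Fin.cons 0 fun i => (σ i).succ : Fin (n + 1) → Fin (m + 1)) = Fin.cons a (v ∘ σ) := by
    intro n m σ v a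
    funext i
    refine Fin.cases ?_ (fun j => ?_) i <;> simp
  induction φ with
  | dist s t => intro m σ v; simp only [rename, eval, Term.eval_rename]
  | P s t z => intro m σ v; simp only [rename, eval, Term.eval_rename]
  | S r s t => intro m σ v; simp only [rename, eval, Term.eval_rename]
  | conn F φ ih => intro m σ v; simp only [rename, eval, ih]
  | inf φ ih => intro m σ v; simp only [rename, eval, ih, cons_comp]
  | sup φ ih => intro m σ v; simp only [rename, eval, ih, cons_comp]

theorem theta_nonneg {t : ℝ} (ht : 0 ≤ t) : 0 ≤ theta t := by unfold theta; positivity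

theorem theta_le_one {t : ℝ} (ht : 0 ≤ t) : theta t ≤ 1 := by
  unfold theta; rw [div_le_one (by positivity)]; linarith

theorem abs_theta_div_le_one {t s : ℝ} (ht : 0 ≤ t) (hs : 0 ≤ s) : |theta t / (1 + s)| ≤ 1 := by
  rw [abs_of_nonneg (div_nonneg (theta_nonneg ht) (by positivity)), div_le_one (by positivity)]
  linarith [theta_le_one ht]

/-- Formulas are bounded, because connectives are continuous and so bounded on products of compact
intervals. Hence the infima and suprema that interpret quantifiers are genuine ones. -/
theorem Formula.exists_abs_eval_le {n : ℕ} (φ : Formula K n) :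
    ∃ C : ℝ, ∀ v : Fin n → Embound X, |φ.eval v| ≤ C := by
  induction φ with
  | dist s t =>
    refine ⟨1, fun v => ?_⟩
    change |distance (s.eval v) (t.eval v)| ≤ 1
    have hinv : ∀ x : X, |1 / (1 + ‖x‖)| ≤ 1 := fun x => by
      rw [abs_of_nonneg (by positivity), div_le_one (by positivity)]
      linarith [norm_nonneg x]
    cases s.eval v <;> cases t.eval v <;> simp only [distance, hinv]
    · exact abs_theta_div_le_one (norm_nonneg _) (by positivity)
    · simp
  | P s t z =>
    refine ⟨1, fun v => ?_⟩
    simp only [eval]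
    cases s.eval v <;> cases t.eval v <;> cases z.eval v <;> simp only [Embound.P, abs_zero,
      zero_le_one]
    exact abs_theta_div_le_one (norm_nonneg _) (by positivity)
  | S r s t =>
    refine ⟨1, fun v => ?_⟩
    simp only [eval]
    cases s.eval v <;> cases t.eval v <;> simp only [Embound.S, abs_zero, zero_le_one]
    exact abs_theta_div_le_one (norm_nonneg _) (by positivity)
  | conn F φ ih =>
    choose C hC using ih
    have hK : IsCompact (Set.univ.pi fun i => Set.Icc (-C i) (C i)) :=
      isCompact_univ_pi fun i => isCompact_Icc
    obtain ⟨B, hB⟩ := hK.exists_bound_of_continuousOn F.continuous.continuousOn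
    exact ⟨B, fun v => hB (fun i => (φ i).eval v) fun i _ => abs_le.mp (hC i v)⟩
  | inf φ ih =>
    obtain ⟨C, hC⟩ := ih
    refine ⟨C, fun v => abs_le.mpr ⟨?_, ?_⟩⟩
    · exact le_ciInf fun a : Embound X => (abs_le.mp (hC _)).1
    · exact (ciInf_le ⟨-C, Set.forall_mem_range.mpr fun a => (abs_le.mp (hC _)).1⟩
        Embound.infty).trans (abs_le.mp (hC _)).2
  | sup φ ih =>
    obtain ⟨C, hC⟩ := ih
    refine ⟨C, fun v => abs_le.mpr ⟨?_, ?_⟩⟩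
    · exact (abs_le.mp (hC _)).1.trans
        (le_ciSup ⟨C, Set.forall_mem_range.mpr fun a => (abs_le.mp (hC _)).2⟩ Embound.infty)
    · exact ciSup_le fun a => (abs_le.mp (hC _)).2

theorem abs_iSup_sub_iSup_le {M N : Type u} [Nonempty M] [Nonempty N] {R : Set (M × N)}
    (hR : IsCorrelation R) {f : M → ℝ} {g : N → ℝ} (hf : BddAbove (Set.range f))
    (hg : BddAbove (Set.range g)) {ε : ℝ} (h : ∀ a b, (a, b) ∈ R → |f a - g b| ≤ ε) :
    |(⨆ a, f a) - ⨆ b, g b| ≤ ε := by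
  rw [abs_le, neg_le_sub_iff_le_add, sub_le_iff_le_add']
  constructor
  · refine ciSup_le fun b => ?_
    obtain ⟨a, ha⟩ := hR.2 b
    linarith [abs_le.mp (h a b ha), le_ciSup hf a]
  · refine ciSup_le fun a => ?_
    obtain ⟨b, hb⟩ := hR.1 a
    linarith [abs_le.mp (h a b hb), le_ciSup hg b]

theorem abs_iInf_sub_iInf_le {M N : Type u} [Nonempty M] [Nonempty N] {R : Set (M × N)}
    (hR : IsCorrelation R) {f : M → ℝ} {g : N → ℝ} (hf : BddBelow (Set.range f))
    (hg : BddBelow (Set.range g)) {ε : ℝ} (h : ∀ a b, (a, b) ∈ R → |f a - g b| ≤ ε) :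
    |(⨅ a, f a) - ⨅ b, g b| ≤ ε := by
  have h1 : (⨅ b, g b) - ε ≤ ⨅ a, f a := le_ciInf fun a => by
    obtain ⟨b, hb⟩ := hR.1 a
    linarith [abs_le.mp (h a b hb), ciInf_le hg b]
  have h2 : (⨅ a, f a) - ε ≤ ⨅ b, g b := le_ciInf fun b => by
    obtain ⟨a, ha⟩ := hR.2 b
    linarith [abs_le.mp (h a b ha), ciInf_le hf a]
  exact abs_le.mpr ⟨by linarith, by linarith⟩

/-- Every formula of `Δ` changes by at most `ε` along `R`. -/
def DistortsAtMost (Δ : FormulaSet K) (R : Set (Embound X × Embound Y)) (ε : ℝ) : Prop :=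
  ∀ (n : ℕ) (φ : Formula K n), φ ∈ Δ n → ∀ (v : Fin n → Embound X) (w : Fin n → Embound Y),
    (∀ i, (v i, w i) ∈ R) → |φ.eval v - φ.eval w| ≤ ε

theorem dis_le_ofReal_iff {Δ : FormulaSet K} {R : Set (Embound X × Embound Y)} {ε : ℝ}
    (hε : 0 ≤ ε) : dis Δ R ≤ ENNReal.ofReal ε ↔ DistortsAtMost Δ R ε := by
  simp only [dis, iSup_le_iff, ENNReal.ofReal_le_ofReal_iff hε, DistortsAtMost]

/-- The closure operations do not increase the distortion of a correlation. -/
theorem DistortsAtMost.closureSet [CompleteSpace X] [CompleteSpace Y] {Δ : FormulaSet K}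
    {R : Set (Embound X × Embound Y)} (hR : IsCorrelation R) {ε : ℝ}
    (h : DistortsAtMost Δ R ε) : DistortsAtMost (closureSet.{u} Δ) R ε := by
  intro n φ hφ
  induction hφ with
  | base hφ => exact h _ _ hφ
  | rename σ _ ih =>
    intro v w hvw
    rw [Formula.eval_rename, Formula.eval_rename]
    exact ih _ _ fun i => hvw _
  | @inf n φ _ ih =>
    intro v w hvw
    obtain ⟨C, hC⟩ := φ.exists_abs_eval_le (X := X)
    obtain ⟨D, hD⟩ := φ.exists_abs_eval_le (X := Y)
    refine abs_iInf_sub_iInf_le hR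
      ⟨-C, Set.forall_mem_range.mpr fun a => (abs_le.mp (hC _)).1⟩
      ⟨-D, Set.forall_mem_range.mpr fun a => (abs_le.mp (hD _)).1⟩ fun a b hab => ih _ _ fun i => ?_
    refine Fin.cases ?_ (fun j => ?_) i
    · exact hab
    · exact hvw j
  | @sup n φ _ ih =>
    intro v w hvw
    obtain ⟨C, hC⟩ := φ.exists_abs_eval_le (X := X)
    obtain ⟨D, hD⟩ := φ.exists_abs_eval_le (X := Y)
    refine abs_iSup_sub_iSup_le hR
      ⟨C, Set.forall_mem_range.mpr fun a => (abs_le.mp (hC _)).2⟩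
      ⟨D, Set.forall_mem_range.mpr fun a => (abs_le.mp (hD _)).2⟩ fun a b hab => ih _ _ fun i => ?_
    refine Fin.cases ?_ (fun j => ?_) i
    · exact hab
    · exact hvw j
  | conn hF _ ih =>
    intro v w hvw
    exact hF _ _ _ fun i => ih i v w hvw
  | equiv _ he ih =>
    intro v w hvw
    rw [← he X v, ← he Y w]
    exact ih v w hvw
  | limit _ hl ih =>
    intro v w hvw
    refine le_of_forall_pos_le_add fun δ hδ => ?_
    obtain ⟨N, hN⟩ := hl (δ / 2) (half_pos hδ)
    have h1 := abs_le.mp (hN N le_rfl X v)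
    have h2 := abs_le.mp (hN N le_rfl Y w)
    have h3 := abs_le.mp (ih N v w hvw)
    exact abs_le.mpr ⟨by linarith, by linarith⟩

theorem dis_BM_le_iff [CompleteSpace X] [CompleteSpace Y] {R : Set (Embound X × Embound Y)}
    (hR : IsCorrelation R) {ε : ℝ} (hε : 0 ≤ ε) :
    dis (BM.{u} K) R ≤ ENNReal.ofReal ε ↔ DistortsAtMost (BM₀.{u} K) R ε :=
  (dis_le_ofReal_iff hε).trans
    ⟨fun h n φ hφ => h n φ (Closure.base hφ), fun h => h.closureSet hR⟩

end Formulas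

/-! ### Scalar estimates -/

theorem abs_clip_sub_clip_le (a b x y : ℝ) : |clip a b x - clip a b y| ≤ |x - y| := by
  unfold clip
  refine (abs_min_sub_min_le_max _ _ _ _).trans ?_
  rw [sub_self, abs_zero, max_eq_left (abs_nonneg _)]
  refine (abs_max_sub_max_le_max _ _ _ _).trans ?_
  rw [sub_self, abs_zero, max_eq_left (abs_nonneg _)]

theorem clip_mem_Icc {a b : ℝ} (h : a ≤ b) (x : ℝ) : clip a b x ∈ Set.Icc a b :=
  ⟨le_min (le_max_right _ _) h, min_le_right _ _⟩

theorem clip_eq_self {a b x : ℝ} (h : x ∈ Set.Icc a b) : clip a b x = x := by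
  rw [clip, max_eq_left h.1, min_eq_left h.2]

theorem clip_eq_left {a b x : ℝ} (h : a ≤ b) (hx : x ≤ a) : clip a b x = a := by
  rw [clip, max_eq_right hx, min_eq_left h]

theorem clip_eq_right {a b x : ℝ} (hx : b ≤ x) : clip a b x = b :=
  min_eq_right (hx.trans (le_max_left _ _))

theorem continuous_clip (a b : ℝ) : Continuous (clip a b) := by unfold clip; fun_prop

theorem cutoff_mem_Icc (r t : ℝ) : cutoff r t ∈ Set.Icc 0 1 := by
  unfold cutoff
  split_ifs
  · simp
  · exact clip_mem_Icc zero_le_one _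

theorem abs_clippedLog_le {r : ℝ} (hr : 0 ≤ r) (t : ℝ) : |clippedLog r t| ≤ r := by
  unfold clippedLog
  split_ifs
  · rw [abs_neg, abs_of_nonneg hr]
  · exact abs_le.mpr (clip_mem_Icc (by linarith) _)

theorem two_sub_inv_pos {r : ℝ} (hr : 1 / 2 < r) : 0 < 2 - r⁻¹ := by
  have : r⁻¹ < 2 := by
    rw [inv_lt_comm₀ (by linarith) two_pos]; linarith
  linarith

theorem abs_log_sub_log_le {δ t t' : ℝ} (ht : 0 < t) (ht' : 0 < t') (h : t ≤ Real.exp δ * t')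
    (h' : t' ≤ Real.exp δ * t) : |Real.log t - Real.log t'| ≤ δ := by
  have h1 := Real.log_le_log ht h
  have h2 := Real.log_le_log ht' h'
  rw [Real.log_mul (Real.exp_ne_zero _) ht'.ne', Real.log_exp] at h1
  rw [Real.log_mul (Real.exp_ne_zero _) ht.ne', Real.log_exp] at h2
  exact abs_le.mpr ⟨by linarith, by linarith⟩

theorem eq_zero_of_le_mul {c t t' : ℝ} (ht : 0 ≤ t) (h : t ≤ c * t') (h0 : t' = 0) : t = 0 :=
  le_antisymm (by simpa [h0] using h) ht

theorem abs_clippedLog_sub_le {r δ t t' : ℝ} (hr : 1 / 2 < r) (hδ : 0 ≤ δ) (ht : 0 ≤ t)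
    (ht' : 0 ≤ t') (h : t ≤ Real.exp δ * t') (h' : t' ≤ Real.exp δ * t) :
    |clippedLog r t - clippedLog r t'| ≤ (2 - r⁻¹) * δ := by
  have hc := two_sub_inv_pos hr
  unfold clippedLog
  by_cases h0 : t = 0
  · rw [if_pos h0, if_pos (eq_zero_of_le_mul ht' h' h0), sub_self, abs_zero]
    positivity
  · have h0' : t' ≠ 0 := fun h2 => h0 (eq_zero_of_le_mul ht h h2)
    rw [if_neg h0, if_neg h0']
    refine (abs_clip_sub_clip_le _ _ _ _).trans ?_
    rw [← mul_sub, abs_mul, abs_of_pos hc]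
    gcongr
    exact abs_log_sub_log_le (lt_of_le_of_ne ht (Ne.symm h0)) (lt_of_le_of_ne ht' (Ne.symm h0')) h h'

theorem abs_cutoff_sub_le {r δ t t' : ℝ} (hδ : 0 ≤ δ) (ht : 0 ≤ t)
    (ht' : 0 ≤ t') (h : t ≤ Real.exp δ * t') (h' : t' ≤ Real.exp δ * t) :
    |cutoff r t - cutoff r t'| ≤ (r ^ 2)⁻¹ * δ := by
  unfold cutoff
  by_cases h0 : t = 0
  · rw [if_pos h0, if_pos (eq_zero_of_le_mul ht' h' h0), sub_self, abs_zero]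
    positivity
  · have h0' : t' ≠ 0 := fun h2 => h0 (eq_zero_of_le_mul ht h h2)
    rw [if_neg h0, if_neg h0']
    refine (abs_clip_sub_clip_le _ _ _ _).trans ?_
    rw [sub_sub_sub_cancel_left, ← mul_sub, abs_mul, abs_of_nonneg (by positivity), abs_sub_comm]
    gcongr
    exact abs_log_sub_log_le (lt_of_le_of_ne ht (Ne.symm h0)) (lt_of_le_of_ne ht' (Ne.symm h0')) h h'

/-- If the arguments change by factors between `e^{-δ}` and `e^δ`, then the product changes by at
most `2δ`: the slope `r⁻²` of the cutoff, times the bound `r` for the logarithm, compensates exactly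
for the slope `2 - r⁻¹` of the logarithm. -/
theorem abs_cutoff_mul_clippedLog_sub_le {r δ m m' t t' : ℝ} (hr : 1 / 2 < r) (hδ : 0 ≤ δ)
    (hm : 0 ≤ m) (hm' : 0 ≤ m') (ht : 0 ≤ t) (ht' : 0 ≤ t')
    (h1 : m ≤ Real.exp δ * m') (h1' : m' ≤ Real.exp δ * m)
    (h2 : t ≤ Real.exp δ * t') (h2' : t' ≤ Real.exp δ * t) :
    |cutoff r m * clippedLog r t - cutoff r m' * clippedLog r t'| ≤ 2 * δ := by
  have hr0 : 0 < r := by linarith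
  have hc := two_sub_inv_pos hr
  calc |cutoff r m * clippedLog r t - cutoff r m' * clippedLog r t'|
      = |(cutoff r m - cutoff r m') * clippedLog r t
          + cutoff r m' * (clippedLog r t - clippedLog r t')| := by congr 1; ring
    _ ≤ |cutoff r m - cutoff r m'| * |clippedLog r t|
          + |cutoff r m'| * |clippedLog r t - clippedLog r t'| := by
        rw [← abs_mul, ← abs_mul]; exact abs_add_le _ _
    _ ≤ ((r ^ 2)⁻¹ * δ) * r + 1 * ((2 - r⁻¹) * δ) := by
        have hcut := cutoff_mem_Icc r m'
        gcongr
        · exact abs_cutoff_sub_le hδ hm hm' h1 h1'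
        · exact abs_clippedLog_le hr0.le t
        · rw [abs_of_nonneg hcut.1]; exact hcut.2
        · exact abs_clippedLog_sub_le hr hδ ht ht' h2 h2'
    _ = 2 * δ := by field_simp; ring

theorem eventually_cutoff_eq_one (m : ℝ) : ∀ᶠ r : ℝ in atTop, cutoff r m = 1 := by
  filter_upwards [eventually_ge_atTop (1 + |Real.log m|)] with r hr
  unfold cutoff
  split_ifs
  · rfl
  · refine clip_eq_right ?_
    have h1 : 1 ≤ r := by linarith [abs_nonneg (Real.log m)]
    have h2 : (r ^ 2)⁻¹ ≤ 1 := inv_le_one_of_one_le₀ (one_le_pow₀ h1)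
    have h3 : (r ^ 2)⁻¹ * Real.log m ≤ 1 * |Real.log m| :=
      (mul_le_mul_of_nonneg_left (le_abs_self _) (by positivity)).trans
        (mul_le_mul_of_nonneg_right h2 (abs_nonneg _))
    linarith

theorem eventually_clippedLog_eq {t : ℝ} (ht : t ≠ 0) :
    ∀ᶠ r : ℝ in atTop, clippedLog r t = (2 - r⁻¹) * Real.log t := by
  filter_upwards [eventually_ge_atTop 1, eventually_ge_atTop (2 * |Real.log t|)] with r hr hr'
  rw [clippedLog, if_neg ht]
  refine clip_eq_self (abs_le.mp (le_trans ?_ hr'))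
  have hc := two_sub_inv_pos (show 1 / 2 < r by linarith)
  rw [abs_mul, abs_of_pos hc]
  gcongr
  linarith [inv_nonneg.mpr (zero_le_one.trans hr)]

theorem tendsto_two_sub_inv : Tendsto (fun r : ℝ => 2 - r⁻¹) atTop (nhds 2) := by
  simpa using tendsto_inv_atTop_zero.const_sub (2 : ℝ)

/-- As `r → ∞` the cutoff disappears, and the clipped logarithm becomes `2 log`, whence the factor
`e^{ε/2}`; it tends to `-∞` at `0`, so that `t = 0` forces `t' = 0`. -/
theorem le_exp_mul_of_forall_abs_sub_le {ε m m' t t' : ℝ} (ht : 0 ≤ t) (ht' : 0 ≤ t')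
    (h : ∀ r : ℝ, 1 / 2 < r →
      |cutoff r m * clippedLog r t - cutoff r m' * clippedLog r t'| ≤ ε) :
    t' ≤ Real.exp (ε / 2) * t := by
  have hev : ∀ᶠ r : ℝ in atTop, |clippedLog r t - clippedLog r t'| ≤ ε := by
    filter_upwards [eventually_cutoff_eq_one m, eventually_cutoff_eq_one m',
      eventually_gt_atTop (1 / 2)] with r h1 h2 hr
    simpa only [h1, h2, one_mul] using h r hr
  rcases eq_or_ne t' 0 with h0' | h0'
  · rw [h0']; positivity
  rcases eq_or_ne t 0 with h0 | h0
  · exfalso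
    have hlim : Tendsto (fun r : ℝ => r + (2 - r⁻¹) * Real.log t') atTop atTop :=
      tendsto_id.atTop_add (tendsto_two_sub_inv.mul_const _)
    obtain ⟨r, h1, h2, h3⟩ := (hev.and ((eventually_clippedLog_eq h0').and
      (hlim.eventually_gt_atTop ε))).exists
    rw [h2, clippedLog, if_pos h0] at h1
    linarith [(abs_le.mp h1).1]
  · have hle : 2 * (Real.log t' - Real.log t) ≤ ε := by
      refine le_of_tendsto (tendsto_two_sub_inv.mul_const _) ?_
      filter_upwards [hev, eventually_clippedLog_eq h0, eventually_clippedLog_eq h0'] with r h1 h2 h3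
      rw [h2, h3] at h1
      linarith [(abs_le.mp h1).1]
    have htp : 0 < t := lt_of_le_of_ne ht (Ne.symm h0)
    have htp' : 0 < t' := lt_of_le_of_ne ht' (Ne.symm h0')
    calc t' = Real.exp (Real.log t') := (Real.exp_log htp').symm
      _ ≤ Real.exp (ε / 2 + Real.log t) := Real.exp_le_exp.mpr (by linarith)
      _ = Real.exp (ε / 2) * t := by rw [Real.exp_add, Real.exp_log htp]

theorem not_forall_abs_cutoff_mul_le (ε m : ℝ) :
    ¬ ∀ r : ℝ, 1 / 2 < r → |cutoff r m * clippedLog r 0| ≤ ε := by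
  intro h
  obtain ⟨r, h1, h2, h3⟩ := ((eventually_cutoff_eq_one m).and
    ((eventually_gt_atTop (1 / 2)).and (eventually_gt_atTop ε))).exists
  have := h r h2
  rw [h1, one_mul, clippedLog, if_pos rfl, abs_neg] at this
  linarith [le_abs_self r]

/-! ### Definability of the Banach-Mazur quantities -/

theorem one_sub_theta {t : ℝ} (ht : 0 ≤ t) : 1 - theta t = (1 + t)⁻¹ := by
  unfold theta; field_simp; ring

theorem theta_lt_one {t : ℝ} (ht : 0 ≤ t) : theta t < 1 := by
  have : 0 < 1 - theta t := by rw [one_sub_theta ht]; positivity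
  linarith

theorem theta_div_one_sub_theta {t : ℝ} (ht : 0 ≤ t) : theta t / (1 - theta t) = t := by
  rw [one_sub_theta ht]; unfold theta; field_simp

theorem theta_le_theta {s t : ℝ} (hs : 0 ≤ s) (hst : s ≤ t) : theta s ≤ theta t := by
  have ht := hs.trans hst
  have := inv_anti₀ (by positivity) (add_le_add_right hst 1)
  rw [← one_sub_theta hs, ← one_sub_theta ht] at this
  linarith

theorem theta_max {s t : ℝ} (hs : 0 ≤ s) (ht : 0 ≤ t) :
    theta (max s t) = max (theta s) (theta t) := by
  rcases le_total s t with h | h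
  · rw [max_eq_right h, max_eq_right (theta_le_theta hs h)]
  · rw [max_eq_left h, max_eq_left (theta_le_theta ht h)]

/-- A continuous function of `log t ∈ [-∞, ∞)` that is constant near `-∞` and near `∞` is a
continuous function of `θ(t)`, and the latter extends to the whole real line. -/
theorem exists_continuousMap_theta {h : ℝ → ℝ} (hc : Continuous h) {lo hi : ℝ} (hlh : lo ≤ hi)
    (hlo : ∀ x ≤ lo, h x = h lo) (hhi : ∀ x ≥ hi, h x = h hi) :
    ∃ G : C(ℝ, ℝ), (∀ t, 0 ≤ t → G (theta t) = if t = 0 then h lo else h (Real.log t)) ∧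
      ∀ p, theta (Real.exp hi) ≤ p → G p = h hi := by
  set a := theta (Real.exp lo)
  set b := theta (Real.exp hi)
  have ha : 0 < a := by simp only [a]; unfold theta; positivity
  have hab : a ≤ b := theta_le_theta (Real.exp_pos _).le (Real.exp_le_exp.mpr hlh)
  have hb : b < 1 := theta_lt_one (Real.exp_pos _).le
  have hcont : Continuous fun p => h (Real.log (clip a b p / (1 - clip a b p))) := by
    refine hc.comp (Continuous.log ?_ fun p => ?_)
    · refine (continuous_clip a b).div (continuous_const.sub (continuous_clip a b)) fun p => ?_
      have := clip_mem_Icc hab p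
      linarith [this.2]
    · have := clip_mem_Icc hab p
      exact (div_pos (by linarith [this.1]) (by linarith [this.2])).ne'
  have hlow : ∀ p ≤ a, h (Real.log (clip a b p / (1 - clip a b p))) = h lo := fun p hp => by
    rw [clip_eq_left hab hp, theta_div_one_sub_theta (Real.exp_pos _).le, Real.log_exp]
  have hhigh : ∀ p, b ≤ p → h (Real.log (clip a b p / (1 - clip a b p))) = h hi := fun p hp => by
    rw [clip_eq_right hp, theta_div_one_sub_theta (Real.exp_pos _).le, Real.log_exp]
  refine ⟨⟨_, hcont⟩, fun t ht => ?_, hhigh⟩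
  simp only [ContinuousMap.coe_mk]
  split_ifs with h0
  · exact hlow _ (by rw [h0, theta, zero_div]; exact ha.le)
  have htp : 0 < t := lt_of_le_of_ne ht (Ne.symm h0)
  rcases le_total (Real.log t) lo with h1 | h1
  · rw [hlo _ h1]
    exact hlow _ (theta_le_theta ht ((Real.log_le_iff_le_exp htp).mp h1))
  rcases le_total hi (Real.log t) with h2 | h2
  · rw [hhi _ h2]
    exact hhigh _ (theta_le_theta (Real.exp_pos _).le ((Real.le_log_iff_exp_le htp).mp h2))
  rw [clip_eq_self ⟨theta_le_theta (Real.exp_pos _).le ((Real.le_log_iff_exp_le htp).mp h1),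
    theta_le_theta ht ((Real.log_le_iff_le_exp htp).mp h2)⟩, theta_div_one_sub_theta ht]

theorem exists_continuousMap_cutoff {r : ℝ} (hr : 0 < r) :
    ∃ G : C(ℝ, ℝ), (∀ t, 0 ≤ t → G (theta t) = cutoff r t) ∧
      ∀ p, theta (Real.exp (r ^ 3)) ≤ p → G p = 0 := by
  have hone : ∀ x ≤ r ^ 2 * (r - 1), clip 0 1 (r - (r ^ 2)⁻¹ * x) = 1 := fun x hx => by
    refine clip_eq_right ?_
    have : (r ^ 2)⁻¹ * x ≤ r - 1 := by rwa [inv_mul_le_iff₀ (by positivity)]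
    linarith
  have hzero : ∀ x ≥ r ^ 3, clip 0 1 (r - (r ^ 2)⁻¹ * x) = 0 := fun x hx => by
    refine clip_eq_left zero_le_one ?_
    have : r ≤ (r ^ 2)⁻¹ * x := by
      rw [le_inv_mul_iff₀ (by positivity)]
      exact le_of_eq_of_le (by ring) hx
    linarith
  obtain ⟨G, hG, hG'⟩ := exists_continuousMap_theta (h := fun x => clip 0 1 (r - (r ^ 2)⁻¹ * x))
    ((continuous_clip _ _).comp (by fun_prop)) (lo := r ^ 2 * (r - 1)) (hi := r ^ 3)
    (by nlinarith [sq_nonneg r])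
    (fun x hx => by rw [hone x hx, hone _ le_rfl]) (fun x hx => by rw [hzero x hx, hzero _ le_rfl])
  refine ⟨G, fun t ht => ?_, fun p hp => ?_⟩
  · rw [hG t ht, hone _ le_rfl, cutoff]
  · rw [hG' p hp, hzero _ le_rfl]

theorem exists_continuousMap_clippedLog {r : ℝ} (hr : 1 / 2 < r) :
    ∃ G : C(ℝ, ℝ), ∀ t, 0 ≤ t → G (theta t) = clippedLog r t := by
  have hc := two_sub_inv_pos hr
  have hr' : -r ≤ r := by linarith
  have hlow : ∀ x ≤ -(r / (2 - r⁻¹)), clip (-r) r ((2 - r⁻¹) * x) = -r := fun x hx => by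
    refine clip_eq_left hr' ?_
    rw [le_neg, div_le_iff₀ hc] at hx
    linarith
  have hhigh : ∀ x ≥ r / (2 - r⁻¹), clip (-r) r ((2 - r⁻¹) * x) = r := fun x hx => by
    refine clip_eq_right ?_
    rw [ge_iff_le, div_le_iff₀ hc] at hx
    linarith
  obtain ⟨G, hG, -⟩ := exists_continuousMap_theta (h := fun x => clip (-r) r ((2 - r⁻¹) * x))
    ((continuous_clip _ _).comp (by fun_prop)) (lo := -(r / (2 - r⁻¹))) (hi := r / (2 - r⁻¹))
    (neg_le_self (div_nonneg (by linarith) hc.le))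
    (fun x hx => by rw [hlow x hx, hlow _ le_rfl]) (fun x hx => by rw [hhigh x hx, hhigh _ le_rfl])
  exact ⟨G, fun t ht => by rw [hG t ht, hlow _ le_rfl, clippedLog]⟩

/-- The value `1` of the first argument corresponds to `m = ∞`. -/
theorem exists_continuousMap_cutoff_mul_clippedLog {r : ℝ} (hr : 1 / 2 < r) :
    ∃ G : C(ℝ × ℝ, ℝ),
      (∀ m t, 0 ≤ m → 0 ≤ t → G (theta m, theta t / (1 + m)) = cutoff r m * clippedLog r t) ∧
      ∀ p, G (1, p) = 0 := by
  obtain ⟨G₁, h₁, h₁'⟩ := exists_continuousMap_cutoff (show 0 < r by linarith)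
  obtain ⟨G₂, h₂⟩ := exists_continuousMap_clippedLog hr
  set b := Real.exp (r ^ 3)
  have hb : 0 ≤ b := (Real.exp_pos _).le
  -- Division by `1 - θ(m) = 1 / (1 + m)` recovers `θ(t)`; the divisor may be bounded away from `0`
  -- because the cutoff vanishes for `m ≥ b`.
  refine ⟨⟨fun z => G₁ z.1 * G₂ (z.2 / max (1 - z.1) (1 - theta b)), ?_⟩,
    fun m t hm ht => ?_, fun p => ?_⟩
  · refine (G₁.continuous.comp continuous_fst).mul (G₂.continuous.comp ?_)
    refine continuous_snd.div (by fun_prop) fun z => ?_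
    exact (lt_of_lt_of_le (sub_pos.mpr (theta_lt_one hb)) (le_max_right _ _)).ne'
  · simp only [ContinuousMap.coe_mk]
    rw [← h₁ m hm]
    rcases le_total m b with h | h
    · rw [max_eq_left (sub_le_sub_left (theta_le_theta hm h) 1), one_sub_theta hm, div_inv_eq_mul,
        div_mul_cancel₀ _ (by positivity), h₂ t ht]
    · rw [h₁' _ (theta_le_theta hb h), zero_mul, zero_mul]
  · simp only [ContinuousMap.coe_mk]
    rw [h₁' _ (theta_le_one hb), zero_mul]

section Definability

variable {K : Type w} [RCLike K]

theorem dist_pt_zero {E : Type u} [NormedAddCommGroup E] (x : E) :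
    Dist.dist (pt x) (pt (0 : E)) = theta ‖x‖ := by
  change theta ‖x - 0‖ / (1 + min ‖x‖ ‖(0 : E)‖) = _
  simp

theorem dist_infty_zero {E : Type u} [NormedAddCommGroup E] :
    Dist.dist Embound.infty (pt (0 : E)) = 1 := by
  change 1 / (1 + ‖(0 : E)‖) = 1
  simp

theorem dist_zero_le_one {E : Type u} [NormedAddCommGroup E] (a : Embound E) :
    Dist.dist a (pt (0 : E)) ≤ 1 := by
  cases a with
  | pt x => rw [dist_pt_zero]; exact theta_le_one (norm_nonneg _)
  | infty => rw [dist_infty_zero]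

theorem exists_formula_eval_eq_phi {r : ℝ} (hr : 1 / 2 < r) {n : ℕ} (t₁ t₂ t₃ : Term n) :
    ∃ χ : Formula K n, ∀ (E : Type u) [NormedAddCommGroup E] [NormedSpace K E]
      (v : Fin n → Embound E), χ.eval v = phi r (t₁.eval v) (t₂.eval v) (t₃.eval v) := by
  obtain ⟨G, hG, hG'⟩ := exists_continuousMap_cutoff_mul_clippedLog hr
  refine ⟨.conn (G.comp ⟨fun f : ℕ → ℝ => (max (max (f 0) (f 1)) (f 2), f 3), by fun_prop⟩)
    fun i => match i with
      | 0 => .dist t₁ .zero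
      | 1 => .dist t₂ .zero
      | 2 => .dist t₃ .zero
      | _ => .P t₁ t₂ t₃, fun E _ _ v => ?_⟩
  simp only [Formula.eval, ContinuousMap.comp_apply, ContinuousMap.coe_mk]
  change G (max (max (Dist.dist (t₁.eval v) (pt 0)) (Dist.dist (t₂.eval v) (pt 0)))
    (Dist.dist (t₃.eval v) (pt 0)), _) = _
  have h1 := dist_zero_le_one (t₁.eval v)
  have h2 := dist_zero_le_one (t₂.eval v)
  have h3 := dist_zero_le_one (t₃.eval v)
  generalize t₁.eval v = a at *
  generalize t₂.eval v = b at *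
  generalize t₃.eval v = c at *
  cases a with
  | infty => rw [dist_infty_zero, max_eq_left h2, max_eq_left h3, hG']; rfl
  | pt x =>
    cases b with
    | infty => rw [dist_infty_zero, max_eq_right h1, max_eq_left h3, hG']; rfl
    | pt y =>
      cases c with
      | infty => rw [dist_infty_zero, max_eq_right (max_le h1 h2), hG']; rfl
      | pt z =>
        rw [dist_pt_zero, dist_pt_zero, dist_pt_zero,
          ← theta_max (norm_nonneg _) (norm_nonneg _), ← theta_max (by positivity) (norm_nonneg _)]
        exact hG _ _ (by positivity) (norm_nonneg _)

theorem exists_formula_eval_eq_psi {r : ℝ} (hr : 1 / 2 < r) (s : K) {n : ℕ} (t₁ t₂ : Term n) :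
    ∃ χ : Formula K n, ∀ (E : Type u) [NormedAddCommGroup E] [NormedSpace K E]
      (v : Fin n → Embound E), χ.eval v = psi r s (t₁.eval v) (t₂.eval v) := by
  obtain ⟨G, hG, hG'⟩ := exists_continuousMap_cutoff_mul_clippedLog hr
  refine ⟨.conn (G.comp ⟨fun f : ℕ → ℝ => (max (f 0) (f 1), f 2), by fun_prop⟩)
    fun i => match i with
      | 0 => .dist t₁ .zero
      | 1 => .dist t₂ .zero
      | _ => .S s t₁ t₂, fun E _ _ v => ?_⟩
  simp only [Formula.eval, ContinuousMap.comp_apply, ContinuousMap.coe_mk]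
  change G (max (Dist.dist (t₁.eval v) (pt 0)) (Dist.dist (t₂.eval v) (pt 0)), _) = _
  have h1 := dist_zero_le_one (t₁.eval v)
  have h2 := dist_zero_le_one (t₂.eval v)
  generalize t₁.eval v = a at *
  generalize t₂.eval v = b at *
  cases a with
  | infty => rw [dist_infty_zero, max_eq_left h2, hG']; rfl
  | pt x =>
    cases b with
    | infty => rw [dist_infty_zero, max_eq_right h1, hG']; rfl
    | pt y =>
      rw [dist_pt_zero, dist_pt_zero, ← theta_max (norm_nonneg _) (norm_nonneg _)]
      exact hG _ _ (by positivity) (norm_nonneg _)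

end Definability

/-! ### Correlations of finite distortion -/

section Correlations

variable {K : Type w} [RCLike K] {X Y : Type u}
  [NormedAddCommGroup X] [NormedSpace K X]
  [NormedAddCommGroup Y] [NormedSpace K Y]
  {R : Set (Embound X × Embound Y)} {ε : ℝ}

theorem DistortsAtMost.abs_phi_sub_phi_le (h : DistortsAtMost (BM₀.{u} K) R ε) {r : ℝ}
    (hr : 1 / 2 < r) {a b c : Embound X} {a' b' c' : Embound Y} (ha : (a, a') ∈ R)
    (hb : (b, b') ∈ R) (hc : (c, c') ∈ R) : |phi r a b c - phi r a' b' c'| ≤ ε := by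
  obtain ⟨χ, hχ⟩ := exists_formula_eval_eq_phi.{u} (K := K) hr (.var (0 : Fin 3)) (.var 1) (.var 2)
  have := h 3 χ (Or.inl ⟨r, hr, _, _, _, Or.inr ⟨_, rfl⟩, Or.inr ⟨_, rfl⟩, Or.inr ⟨_, rfl⟩,
    fun E _ _ _ v => hχ E v⟩) ![a, b, c] ![a', b', c'] (fun i => by fin_cases i <;> assumption)
  rwa [hχ X, hχ Y] at this

theorem DistortsAtMost.abs_psi_sub_psi_le (h : DistortsAtMost (BM₀.{u} K) R ε) {r : ℝ}
    (hr : 1 / 2 < r) (s : K) {a b : Embound X} {a' b' : Embound Y} (ha : (a, a') ∈ R)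
    (hb : (b, b') ∈ R) : |psi r s a b - psi r s a' b'| ≤ ε := by
  obtain ⟨χ, hχ⟩ := exists_formula_eval_eq_psi.{u} (K := K) hr s (.var (0 : Fin 2)) (.var 1)
  have := h 2 χ (Or.inr ⟨r, hr, s, _, _, Or.inr ⟨_, rfl⟩, Or.inr ⟨_, rfl⟩,
    fun E _ _ _ v => hχ E v⟩) ![a, b] ![a', b'] (fun i => by fin_cases i <;> assumption)
  rwa [hχ X, hχ Y] at this

theorem DistortsAtMost.norm_add_sub_le (h : DistortsAtMost (BM₀.{u} K) R ε)
    {x y z : X} {x' y' z' : Y} (hx : (pt x, pt x') ∈ R) (hy : (pt y, pt y') ∈ R)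
    (hz : (pt z, pt z') ∈ R) : ‖x' + y' - z'‖ ≤ Real.exp (ε / 2) * ‖x + y - z‖ :=
  le_exp_mul_of_forall_abs_sub_le (norm_nonneg _) (norm_nonneg _)
    fun _ hr => h.abs_phi_sub_phi_le hr hx hy hz

theorem DistortsAtMost.norm_smul_sub_le (h : DistortsAtMost (BM₀.{u} K) R ε) (s : K)
    {x y : X} {x' y' : Y} (hx : (pt x, pt x') ∈ R) (hy : (pt y, pt y') ∈ R) :
    ‖s • x' - y'‖ ≤ Real.exp (ε / 2) * ‖s • x - y‖ ∧
      ‖s • x - y‖ ≤ Real.exp (ε / 2) * ‖s • x' - y'‖ :=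
  ⟨le_exp_mul_of_forall_abs_sub_le (norm_nonneg _) (norm_nonneg _)
      fun _ hr => h.abs_psi_sub_psi_le hr s hx hy,
    le_exp_mul_of_forall_abs_sub_le (norm_nonneg _) (norm_nonneg _)
      fun _ hr => by rw [abs_sub_comm]; exact h.abs_psi_sub_psi_le hr s hx hy⟩

/-- The quantities `ψ_{r,1}(x, x)` tend to `-∞` for `x ≠ ∞` and vanish at `∞`. -/
theorem DistortsAtMost.eq_infty_iff (h : DistortsAtMost (BM₀.{u} K) R ε)
    {a : Embound X} {b : Embound Y} (hab : (a, b) ∈ R) : a = Embound.infty ↔ b = Embound.infty := by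
  cases a with
  | infty =>
    cases b with
    | infty => simp
    | pt y =>
      refine (not_forall_abs_cutoff_mul_le ε ‖y‖ fun r hr => ?_).elim
      simpa [psi] using h.abs_psi_sub_psi_le hr (1 : K) hab hab
  | pt x =>
    cases b with
    | infty =>
      refine (not_forall_abs_cutoff_mul_le ε ‖x‖ fun r hr => ?_).elim
      simpa [psi] using h.abs_psi_sub_psi_le hr (1 : K) hab hab
    | pt y => simp

theorem DistortsAtMost.pt_eq_iff (h : DistortsAtMost (BM₀.{u} K) R ε)
    {x y : X} {x' y' : Y} (hx : (pt x, pt x') ∈ R) (hy : (pt y, pt y') ∈ R) : x = y ↔ x' = y' := by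
  obtain ⟨h1, h2⟩ := h.norm_smul_sub_le (1 : K) hx hy
  rw [one_smul, one_smul] at h1 h2
  rw [← sub_eq_zero, ← sub_eq_zero (a := x'), ← norm_eq_zero, ← norm_eq_zero (a := x' - y')]
  exact ⟨eq_zero_of_le_mul (norm_nonneg _) h1, eq_zero_of_le_mul (norm_nonneg _) h2⟩

theorem DistortsAtMost.exists_equiv (hR : IsCorrelation R)
    (h : DistortsAtMost (BM₀.{u} K) R ε) :
    ∃ A : X ≃L[K] Y, R = graphWithInfty A ∧
      ‖(A : X →L[K] Y)‖ ≤ √(Real.exp ε) ∧ ‖(A.symm : Y →L[K] X)‖ ≤ √(Real.exp ε) := by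
  have hf : ∀ x : X, ∃ y : Y, (pt x, pt y) ∈ R := fun x => by
    obtain ⟨b, hb⟩ := hR.1 (pt x)
    cases b with
    | pt y => exact ⟨y, hb⟩
    | infty => exact absurd ((h.eq_infty_iff hb).mpr rfl) (by simp)
  have hg : ∀ y : Y, ∃ x : X, (pt x, pt y) ∈ R := fun y => by
    obtain ⟨a, ha⟩ := hR.2 (pt y)
    cases a with
    | pt x => exact ⟨x, ha⟩
    | infty => exact absurd ((h.eq_infty_iff ha).mp rfl) (by simp)
  choose f hf using hf
  choose g hg using hg
  let e : X ≃ₗ[K] Y :=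
    { toFun := f
      invFun := g
      left_inv := fun x => (h.pt_eq_iff (hg (f x)) (hf x)).mpr rfl
      right_inv := fun y => (h.pt_eq_iff (hf (g y)) (hg y)).mp rfl
      map_add' := fun x y => by
        have := h.norm_add_sub_le (hf x) (hf y) (hf (x + y))
        rw [sub_self, norm_zero, mul_zero, norm_le_zero_iff, sub_eq_zero] at this
        exact this.symm
      map_smul' := fun s x => by
        have := (h.norm_smul_sub_le s (hf x) (hf (s • x))).1
        rw [sub_self, norm_zero, mul_zero, norm_le_zero_iff, sub_eq_zero] at this
        exact this.symm }
  have hnorm : ∀ {x : X} {y : Y}, (pt x, pt y) ∈ R →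
      ‖y‖ ≤ Real.exp (ε / 2) * ‖x‖ ∧ ‖x‖ ≤ Real.exp (ε / 2) * ‖y‖ := fun {x y} hxy => by
    simpa using h.norm_smul_sub_le (0 : K) hxy hxy
  have h1 : ∀ x, ‖e x‖ ≤ Real.exp (ε / 2) * ‖x‖ := fun x => (hnorm (hf x)).1
  have h2 : ∀ y, ‖e.symm y‖ ≤ Real.exp (ε / 2) * ‖y‖ := fun y => (hnorm (hg y)).2
  refine ⟨e.toContinuousLinearEquivOfBounds _ _ h1 h2, ?_, ?_, ?_⟩
  · ext ⟨a, b⟩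
    constructor
    · intro hab
      cases a with
      | pt x =>
        cases b with
        | pt y =>
          exact Or.inl ⟨x, Prod.ext rfl (congrArg pt ((h.pt_eq_iff hab (hf x)).mp rfl))⟩
        | infty => exact absurd ((h.eq_infty_iff hab).mpr rfl) (by simp)
      | infty => exact Or.inr (Prod.ext rfl ((h.eq_infty_iff hab).mp rfl))
    · rintro (⟨x, hx⟩ | hx)
      · rw [hx]; exact hf x
      · obtain ⟨b, hb⟩ := hR.1 Embound.infty
        rw [(h.eq_infty_iff hb).mp rfl] at hb
        rwa [hx]
  · rw [← Real.exp_half]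
    exact ContinuousLinearMap.opNorm_le_bound _ (Real.exp_pos _).le h1
  · rw [← Real.exp_half]
    exact ContinuousLinearMap.opNorm_le_bound _ (Real.exp_pos _).le h2

/-! ### Graphs of linear homeomorphisms -/

theorem isCorrelation_graphWithInfty (A : X ≃L[K] Y) : IsCorrelation (graphWithInfty A) := by
  constructor
  · rintro (x | _)
    · exact ⟨_, Or.inl ⟨x, rfl⟩⟩
    · exact ⟨_, Or.inr rfl⟩
  · rintro (y | _)
    · exact ⟨pt (A.symm y), Or.inl ⟨A.symm y, by rw [A.apply_symm_apply]⟩⟩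
    · exact ⟨_, Or.inr rfl⟩

theorem Term.IsVarOrZero.eval_mem_graphWithInfty {A : X ≃L[K] Y} {n : ℕ} {t : Term n}
    (ht : t.IsVarOrZero) {v : Fin n → Embound X} {w : Fin n → Embound Y}
    (hvw : ∀ i, (v i, w i) ∈ graphWithInfty A) : (t.eval v, t.eval w) ∈ graphWithInfty A := by
  obtain rfl | ⟨i, rfl⟩ := ht
  · exact Or.inl ⟨0, by rw [map_zero]; rfl⟩
  · exact hvw i

theorem max_le_mul_max {c a b a' b' : ℝ} (hc : 0 ≤ c) (ha : a ≤ c * a') (hb : b ≤ c * b') :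
    max a b ≤ c * max a' b' := by
  rw [mul_max_of_nonneg _ _ hc]
  exact max_le_max ha hb

theorem distortsAtMost_graphWithInfty [CompleteSpace X] [CompleteSpace Y] {A : X ≃L[K] Y}
    (hε : 0 ≤ ε)
    (h1 : ‖(A : X →L[K] Y)‖ ≤ √(Real.exp ε)) (h2 : ‖(A.symm : Y →L[K] X)‖ ≤ √(Real.exp ε)) :
    DistortsAtMost (BM₀.{u} K) (graphWithInfty A) ε := by
  rw [← Real.exp_half] at h1 h2
  have hA : ∀ x, ‖A x‖ ≤ Real.exp (ε / 2) * ‖x‖ := fun x =>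
    (A : X →L[K] Y).le_of_opNorm_le h1 x
  have hA' : ∀ x, ‖x‖ ≤ Real.exp (ε / 2) * ‖A x‖ := fun x => by
    simpa using (A.symm : Y →L[K] X).le_of_opNorm_le h2 (A x)
  have hε2 : 0 ≤ ε / 2 := by linarith
  have hpos := (Real.exp_pos (ε / 2)).le
  have hhalf : 2 * (ε / 2) = ε := by ring
  rintro n χ (⟨r, hr, t₁, t₂, t₃, ht₁, ht₂, ht₃, hχ⟩ | ⟨r, hr, s, t₁, t₂, ht₁, ht₂, hχ⟩) v w hvw
  · rw [hχ X, hχ Y]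
    rcases ht₁.eval_mem_graphWithInfty hvw with ⟨x, hx⟩ | hx <;>
    rcases ht₂.eval_mem_graphWithInfty hvw with ⟨y, hy⟩ | hy <;>
    rcases ht₃.eval_mem_graphWithInfty hvw with ⟨z, hz⟩ | hz <;>
    rw [Prod.mk.injEq] at hx hy hz <;>
    rw [hx.1, hx.2, hy.1, hy.2, hz.1, hz.2] <;>
    simp only [phi, sub_self, abs_zero, hε]
    have hlin : A x + A y - A z = A (x + y - z) := by rw [map_sub, map_add]
    rw [hlin, ← hhalf]
    exact abs_cutoff_mul_clippedLog_sub_le hr hε2 (by positivity) (by positivity) (norm_nonneg _)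
      (norm_nonneg _)
      (max_le_mul_max hpos (max_le_mul_max hpos (hA' x) (hA' y)) (hA' z))
      (max_le_mul_max hpos (max_le_mul_max hpos (hA x) (hA y)) (hA z)) (hA' _) (hA _)
  · rw [hχ X, hχ Y]
    rcases ht₁.eval_mem_graphWithInfty hvw with ⟨x, hx⟩ | hx <;>
    rcases ht₂.eval_mem_graphWithInfty hvw with ⟨y, hy⟩ | hy <;>
    rw [Prod.mk.injEq] at hx hy <;>
    rw [hx.1, hx.2, hy.1, hy.2] <;>
    simp only [psi, sub_self, abs_zero, hε]
    have hlin : s • A x - A y = A (s • x - y) := by rw [map_sub, map_smul]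
    rw [hlin, ← hhalf]
    exact abs_cutoff_mul_clippedLog_sub_le hr hε2 (by positivity) (by positivity) (norm_nonneg _)
      (norm_nonneg _) (max_le_mul_max hpos (hA' x) (hA' y)) (max_le_mul_max hpos (hA x) (hA y))
      (hA' _) (hA _)

/-- Rescaling makes the norms of `A` and of its inverse equal. -/
theorem exists_equiv_norm_le_sqrt (A : X ≃L[K] Y) :
    ∃ B : X ≃L[K] Y,
      ‖(B : X →L[K] Y)‖ ≤ √(‖(A : X →L[K] Y)‖ * ‖(A.symm : Y →L[K] X)‖) ∧
      ‖(B.symm : Y →L[K] X)‖ ≤ √(‖(A : X →L[K] Y)‖ * ‖(A.symm : Y →L[K] X)‖) := by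
  rcases subsingleton_or_nontrivial X with hX | hX
  · have hY : Subsingleton Y := A.symm.toEquiv.subsingleton
    exact ⟨A, by simp [Subsingleton.elim (A : X →L[K] Y) 0],
      by simp [Subsingleton.elim (A.symm : Y →L[K] X) 0]⟩
  have ha : 0 < ‖(A : X →L[K] Y)‖ := A.norm_pos
  have hb : 0 < ‖(A.symm : Y →L[K] X)‖ := A.norm_symm_pos
  set a := ‖(A : X →L[K] Y)‖
  set b := ‖(A.symm : Y →L[K] X)‖
  have hc : 0 < √b / √a := by positivity
  have hc' : ((√b / √a : ℝ) : K) ≠ 0 := RCLike.ofReal_ne_zero.mpr hc.ne'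
  have hnorm : ‖((√b / √a : ℝ) : K)‖ = √b / √a := by
    rw [RCLike.norm_ofReal, abs_of_pos hc]
  have hsa : √a * √a = a := Real.mul_self_sqrt ha.le
  have hsb : √b * √b = b := Real.mul_self_sqrt hb.le
  have hsa0 : √a ≠ 0 := by positivity
  have hsb0 : √b ≠ 0 := by positivity
  let e : X ≃ₗ[K] Y := A.toLinearEquiv.trans (LinearEquiv.smulOfNeZero K Y _ hc')
  have h1 : ∀ x, ‖e x‖ ≤ √(a * b) * ‖x‖ := fun x => by
    change ‖((√b / √a : ℝ) : K) • A x‖ ≤ _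
    rw [norm_smul, hnorm, Real.sqrt_mul ha.le]
    calc √b / √a * ‖A x‖ ≤ √b / √a * (a * ‖x‖) := by
          gcongr; exact (A : X →L[K] Y).le_opNorm x
      _ = √a * √b * ‖x‖ := by nth_rewrite 2 [← hsa]; field_simp
  have h2 : ∀ y, ‖e.symm y‖ ≤ √(a * b) * ‖y‖ := fun y => by
    change ‖A.symm (((√b / √a : ℝ) : K)⁻¹ • y)‖ ≤ _
    rw [map_smul, norm_smul, norm_inv, hnorm, Real.sqrt_mul ha.le]
    calc (√b / √a)⁻¹ * ‖A.symm y‖ ≤ (√b / √a)⁻¹ * (b * ‖y‖) := by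
          gcongr; exact (A.symm : Y →L[K] X).le_opNorm y
      _ = √a * √b * ‖y‖ := by nth_rewrite 2 [← hsb]; field_simp
  exact ⟨e.toContinuousLinearEquivOfBounds _ _ h1 h2,
    ContinuousLinearMap.opNorm_le_bound _ (by positivity) h1,
    ContinuousLinearMap.opNorm_le_bound _ (by positivity) h2⟩

theorem exists_equiv_norm_le_sqrt_exp (A : X ≃L[K] Y) :
    ∃ ε : ℝ, 0 ≤ ε ∧
      ENNReal.ofReal ε =
        ENNReal.ofReal (Real.log (‖(A : X →L[K] Y)‖ * ‖(A.symm : Y →L[K] X)‖)) ∧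
      ∃ B : X ≃L[K] Y, ‖(B : X →L[K] Y)‖ ≤ √(Real.exp ε) ∧
        ‖(B.symm : Y →L[K] X)‖ ≤ √(Real.exp ε) := by
  obtain ⟨B, h1, h2⟩ := exists_equiv_norm_le_sqrt A
  set p := ‖(A : X →L[K] Y)‖ * ‖(A.symm : Y →L[K] X)‖
  have hp : p ≤ Real.exp (max (Real.log p) 0) :=
    (Real.le_exp_log p).trans (Real.exp_le_exp.mpr (le_max_left _ _))
  refine ⟨max (Real.log p) 0, le_max_right _ _, ?_, B, h1.trans (Real.sqrt_le_sqrt hp),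
    h2.trans (Real.sqrt_le_sqrt hp)⟩
  rw [ENNReal.ofReal_max, ENNReal.ofReal_zero, max_eq_left zero_le]

theorem rho_BM_eq_banachMazurDist [CompleteSpace X] [CompleteSpace Y] :
    rho X Y (BM.{u} K) = banachMazurDist K X Y := by
  refine le_antisymm (le_iInf fun A => ?_) (le_iInf₂ fun R hR => ?_)
  · obtain ⟨ε, hε, hεA, B, h1, h2⟩ := exists_equiv_norm_le_sqrt_exp A
    rw [← hεA]
    have hB := isCorrelation_graphWithInfty B
    exact (iInf₂_le _ hB).trans
      ((dis_BM_le_iff hB hε).mpr (distortsAtMost_graphWithInfty hε h1 h2))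
  · rcases eq_or_ne (dis (BM.{u} K) R) ⊤ with htop | htop
    · rw [htop]; exact le_top
    rw [← ENNReal.ofReal_toReal htop]
    obtain ⟨A, -, h1, h2⟩ := ((dis_BM_le_iff hR ENNReal.toReal_nonneg).mp
      (ENNReal.ofReal_toReal htop).ge).exists_equiv hR
    refine (iInf_le _ A).trans (ENNReal.ofReal_le_ofReal ?_)
    have hmul := mul_le_mul h1 h2 (norm_nonneg _) (Real.sqrt_nonneg _)
    rw [Real.mul_self_sqrt (Real.exp_pos _).le] at hmul
    -- If `X` is the zero space, then the product of the norms is `0`, and so is its `Real.log`.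
    rcases (mul_nonneg (norm_nonneg (A : X →L[K] Y))
      (norm_nonneg (A.symm : Y →L[K] X))).eq_or_lt with h0 | h0
    · rw [← h0, Real.log_zero]; exact ENNReal.toReal_nonneg
    · exact (Real.log_le_iff_le_exp h0).mpr hmul

end Correlations

end Emboundment

theorem mainTheorem6 {K : Type w} [RCLike K] {X Y : Type u}
    [NormedAddCommGroup X] [NormedSpace K X] [CompleteSpace X]
    [NormedAddCommGroup Y] [NormedSpace K Y] [CompleteSpace Y] :
    (∀ R : Set (Emboundment.Embound X × Emboundment.Embound Y),
      Emboundment.IsCorrelation R → IsClosed R → ∀ ε : ℝ, 0 ≤ ε →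
      (Emboundment.dis (Emboundment.BM.{u} K) R ≤ ENNReal.ofReal ε ↔
        ∃ A : X ≃L[K] Y, R = Emboundment.graphWithInfty A ∧
          ‖(A : X →L[K] Y)‖ ≤ √(Real.exp ε) ∧ ‖(A.symm : Y →L[K] X)‖ ≤ √(Real.exp ε))) ∧
    Emboundment.rho X Y (Emboundment.BM.{u} K) = Emboundment.banachMazurDist K X Y := by
  refine ⟨fun R hR _ ε hε => ?_, Emboundment.rho_BM_eq_banachMazurDist⟩
  rw [Emboundment.dis_BM_le_iff hR hε]
  constructor
  · exact fun h => h.exists_equiv hR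
  · rintro ⟨A, rfl, h1, h2⟩
    exact Emboundment.distortsAtMost_graphWithInfty hε h1 h2
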